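/- Let $C$ be a field of characteristic zero and $n\ge 1$. Let $\mathcal R=C\{u_2,\dots,u_n\}=C[u_\ell^{(k)} : 2\le \ell\le n,\ k\ge 0]$ be the ring of differential polynomials, with the derivation $\partial$ that vanishes on $C$ and satisfies $\partial(u_\ell^{(k)})=u_\ell^{(k+1)}$. Let $\mathcal R((\partial^{-1}))$ be the ring of formal pseudo-differential operators $\sum_{i\le N}a_i\partial^i$ ($N\in\mathbb Z$, $a_i\in\mathcal R$), with product determined by $\partial^i a=\sum_{m\ge0}\binom{i}{m}\partial^m(a)\,\partial^{i-m}$ for $i\in\mathbb Z$, $a\in\mathcal R$, and let $\mathcal R[\partial]$ be its subring of differential operators ($a_i=0$ for $i<0$). For $A=\sum_i a_i\partial^i$ put $A_+=\sum_{i\ge 0}a_i\partial^i$; the order $\operatorname{ord}A$ is the largest $i$ with $a_i\ne0$ (and $\operatorname{ord}0=-\infty$); $A$ is monic if its leading coefficient is $1$, and in normal form if moreover the coefficient of $\partial^{\operatorname{ord}A-1}$ is $0$. Give $\mathcal R$ the weight with $w(u_\ell^{(k)})=\ell+k$ and $w(c)=0$ for $c\in C\setminus\{0\}$; an operator $P\in\mathcal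 R[\partial]$ is homogeneous of weight $r$ if, for every $i$, the coefficient of $\partial^i$ in $P$ is homogeneous of weight $r-i$ (zero being homogeneous of every weight). Let $L=\partial^n+u_2\partial^{n-2}+\dots+u_{n-1}\partial+u_n$ and let $W(L)=\{A\in\mathcal R[\partial] : \operatorname{ord}(LA-AL)\le n-2\}$, a $C$-vector space. Then there is a unique monic pseudo-differential operator $Q\in\mathcal R((\partial^{-1}))$ of order $1$ with $Q^n=L$. Put $P_j=(Q^j)_+$ for $j\in\mathbb N=\{0,1,2,\dots\}$. Then (1) $(P_j)_{j\in\mathbb N}$ is a $C$-basis of $W(L)$, and each $P_j$ is homogeneous of weight $j$; (2) if $(T_j)_{j\in\mathbb N}$ is any $C$-basis of $W(L)$ such that each $T_j$ is homogeneous of weight $j$, then for every $j$ there is $c_j\in C\setminus\{0\}$ with $T_j=c_jP_j$; (3) each $P_j$ is monic and in normal form. -/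

import Mathlib

/-- Summing over the fibres of a map. -/
theorem finsum_eq_finsum_fiber {α β M : Type*} [AddCommMonoid M] {g : β → M}
    (hg : g.HasFiniteSupport) (h : β → α) (fib : α → Finset β)
    (hfib : ∀ x y, y ∈ fib x ↔ h y = x) :
    ∑ᶠ y, g y = ∑ᶠ x, ∑ y ∈ fib x, g y := by
  classical
  have hg' : (Function.support g).Finite := hg
  have h1 : (Function.support fun x => ∑ y ∈ fib x, g y) ⊆ ↑(hg'.toFinset.image h) := by
    intro x hx
    obtain ⟨y, hy, hy'⟩ := Finset.exists_ne_zero_of_sum_ne_zero hx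
    simp only [Finset.coe_image, Set.mem_image, Finset.mem_coe, Set.Finite.mem_toFinset]
    exact ⟨y, hy', (hfib x y).1 hy⟩
  rw [finsum_eq_sum_of_support_subset _ h1,
    finsum_eq_sum_of_support_subset g (s := hg'.toFinset) (by simp),
    ← Finset.sum_fiberwise_of_maps_to (g := h) (t := hg'.toFinset.image h)
      (fun y hy => Finset.mem_image_of_mem h hy)]
  refine Finset.sum_congr rfl fun x _ => Finset.sum_subset ?_ ?_
  · intro y hy
    exact (hfib x y).2 (Finset.mem_filter.1 hy).2
  · intro y hy hy'
    by_contra hne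
    exact hy' (Finset.mem_filter.2 ⟨by simpa using hne, (hfib x y).1 hy⟩)

/-- Higher Leibniz rule. -/
theorem Derivation.pow_leibniz {C R : Type*} [CommRing C] [CommRing R] [Algebra C R]
    (D : Derivation C R R) (s : ℕ) (a b : R) :
    ((D : R →ₗ[C] R) ^ s) (a * b) = ∑ p ∈ Finset.HasAntidiagonal.antidiagonal s,
      s.choose p.1 • (((D : R →ₗ[C] R) ^ p.1) a * ((D : R →ₗ[C] R) ^ p.2) b) := by
  induction s with
  | zero => simp
  | succ s ih =>
    have key := Finset.sum_antidiagonal_choose_succ_nsmul (M := R)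
      (fun i j => ((D : R →ₗ[C] R) ^ i) a * ((D : R →ₗ[C] R) ^ j) b) s
    rw [key, pow_succ', Module.End.mul_apply, ih, map_sum, ← Finset.sum_add_distrib]
    refine Finset.sum_congr rfl fun p hp => ?_
    have h2 : s.choose p.2 = s.choose p.1 :=
      Nat.choose_symm_of_eq_add (by rw [← Finset.HasAntidiagonal.mem_antidiagonal.1 hp, add_comm])
    rw [map_nsmul, h2, ← smul_add]
    congr 1
    simp only [Derivation.coeFn_coe, Derivation.leibniz, smul_eq_mul, pow_succ',
      Module.End.mul_apply]
    ring

/-- Formal pseudo-differential operators `∑_{i ≤ N} aᵢ ∂ⁱ` (with `N` an integer depending on the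
operator) over a commutative ring `R` with a derivation `D`; `coeff i` is the coefficient `aᵢ`. -/
@[ext]
structure PseudoDiffOp {C R : Type*} [CommRing C] [CommRing R] [Algebra C R]
    (D : Derivation C R R) where
  coeff : ℤ → R
  bddAbove' : ∃ N : ℤ, ∀ i, N < i → coeff i = 0

namespace PseudoDiffOp

variable {C R : Type*} [CommRing C] [CommRing R] [Algebra C R] {D : Derivation C R R}

instance : Zero (PseudoDiffOp D) := ⟨⟨0, 0, fun _ _ => rfl⟩⟩

instance : Add (PseudoDiffOp D) :=
  ⟨fun A B => ⟨A.coeff + B.coeff, by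
    obtain ⟨M, hM⟩ := A.bddAbove'
    obtain ⟨N, hN⟩ := B.bddAbove'
    exact ⟨max M N, fun i hi => by
      simp [hM i (lt_of_le_of_lt (le_max_left _ _) hi),
        hN i (lt_of_le_of_lt (le_max_right _ _) hi)]⟩⟩⟩

instance : Neg (PseudoDiffOp D) :=
  ⟨fun A => ⟨-A.coeff, by
    obtain ⟨M, hM⟩ := A.bddAbove'
    exact ⟨M, fun i hi => by simp [hM i hi]⟩⟩⟩

instance : Sub (PseudoDiffOp D) :=
  ⟨fun A B => ⟨A.coeff - B.coeff, by
    obtain ⟨M, hM⟩ := (A + -B).bddAbove'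
    exact ⟨M, fun i hi => by
      have := hM i hi
      rwa [show (A + -B).coeff i = A.coeff i + -B.coeff i from rfl, ← sub_eq_add_neg] at this⟩⟩⟩

instance {S : Type*} [SMulZeroClass S R] : SMul S (PseudoDiffOp D) :=
  ⟨fun c A => ⟨c • A.coeff, by
    obtain ⟨M, hM⟩ := A.bddAbove'
    exact ⟨M, fun i hi => by simp [hM i hi]⟩⟩⟩

@[simp] theorem coeff_zero (i : ℤ) : (0 : PseudoDiffOp D).coeff i = 0 := rfl

@[simp] theorem coeff_add (A B : PseudoDiffOp D) (i : ℤ) :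
    (A + B).coeff i = A.coeff i + B.coeff i := rfl

@[simp] theorem coeff_neg (A : PseudoDiffOp D) (i : ℤ) : (-A).coeff i = -A.coeff i := rfl

@[simp] theorem coeff_sub (A B : PseudoDiffOp D) (i : ℤ) :
    (A - B).coeff i = A.coeff i - B.coeff i := rfl

@[simp] theorem coeff_smul {S : Type*} [SMulZeroClass S R] (c : S) (A : PseudoDiffOp D) (i : ℤ) :
    (c • A).coeff i = c • A.coeff i := rfl

theorem coeff_injective : Function.Injective (coeff : PseudoDiffOp D → ℤ → R) :=
  fun _ _ h => PseudoDiffOp.ext h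

instance : AddCommGroup (PseudoDiffOp D) :=
  coeff_injective.addCommGroup coeff rfl (fun _ _ => rfl) (fun _ => rfl) (fun _ _ => rfl)
    (fun _ _ => rfl) (fun _ _ => rfl)

/-- The coefficient map as an additive homomorphism. -/
def coeffHom (D : Derivation C R R) : PseudoDiffOp D →+ (ℤ → R) where
  toFun := coeff
  map_zero' := rfl
  map_add' _ _ := rfl

instance : Module C (PseudoDiffOp D) :=
  coeff_injective.module C (coeffHom D) (fun _ _ => rfl)

/-- The monomial `r ∂ⁱ`. -/
def single (D : Derivation C R R) (i : ℤ) (r : R) : PseudoDiffOp D where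
  coeff k := if k = i then r else 0
  bddAbove' := ⟨i, fun _ hk => if_neg hk.ne'⟩

theorem coeff_single (i : ℤ) (r : R) (k : ℤ) :
    (single D i r).coeff k = if k = i then r else 0 := rfl

instance : One (PseudoDiffOp D) := ⟨single D 0 1⟩

theorem coeff_one (k : ℤ) : (1 : PseudoDiffOp D).coeff k = if k = 0 then 1 else 0 := rfl

/-- The contribution of `aᵢ ∂ⁱ` and of the `m`-th term of `∂ⁱ b = ∑ₘ binom(i, m) D^m(b) ∂^{i-m}`
to the coefficient of `∂ᵏ` in a product. -/
noncomputable def mulTerm (A B : PseudoDiffOp D) (k : ℤ) (p : ℤ × ℕ) : R :=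
  Ring.choose p.1 p.2 •
    (A.coeff p.1 * ((D : R →ₗ[C] R) ^ p.2) (B.coeff (k - p.1 + p.2)))

theorem mulTerm_finite (A B : PseudoDiffOp D) (k : ℤ) :
    (mulTerm A B k).HasFiniteSupport := by
  obtain ⟨M, hM⟩ := A.bddAbove'
  obtain ⟨N, hN⟩ := B.bddAbove'
  refine Set.Finite.subset ((Set.finite_Icc (k - N) M).prod
    (Set.finite_Iic (N + M - k).toNat)) ?_
  rintro ⟨i, m⟩ h
  have h1 : i ≤ M := by
    by_contra hc
    exact h (by simp [mulTerm, hM i (by omega)])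
  have h2 : k - i + m ≤ N := by
    by_contra hc
    exact h (by simp [mulTerm, hN (k - i + m) (by omega)])
  simp only [Set.mem_prod, Set.mem_Icc, Set.mem_Iic]
  omega

/-- The product determined by `∂ⁱ b = ∑_{m ≥ 0} binom(i, m) D^m(b) ∂^{i-m}` for all `i : ℤ`. -/
noncomputable instance : Mul (PseudoDiffOp D) :=
  ⟨fun A B => ⟨fun k => ∑ᶠ p : ℤ × ℕ, mulTerm A B k p, by
    obtain ⟨M, hM⟩ := A.bddAbove'
    obtain ⟨N, hN⟩ := B.bddAbove'
    refine ⟨M + N, fun k hk => finsum_eq_zero_of_forall_eq_zero ?_⟩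
    rintro ⟨i, m⟩
    rcases lt_or_ge M i with h | h
    · simp [mulTerm, hM i h]
    · simp [mulTerm, hN (k - i + m) (by omega)]⟩⟩

theorem coeff_mul (A B : PseudoDiffOp D) (k : ℤ) :
    (A * B).coeff k = ∑ᶠ p : ℤ × ℕ, mulTerm A B k p := rfl

theorem one_mul' (A : PseudoDiffOp D) : 1 * A = A := by
  ext k
  rw [coeff_mul, finsum_eq_single _ (0, 0)]
  · simp [mulTerm, coeff_one]
  · rintro ⟨i, m⟩ h
    by_cases hi : i = 0
    · subst hi
      have : 0 < m := Nat.pos_of_ne_zero (by rintro rfl; exact h rfl)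
      simp [mulTerm, Ring.choose_zero_pos ℤ this]
    · simp [mulTerm, coeff_one, hi]

theorem mul_one' (A : PseudoDiffOp D) : A * 1 = A := by
  ext k
  rw [coeff_mul, finsum_eq_single _ (k, 0)]
  · simp [mulTerm, coeff_one]
  · rintro ⟨i, m⟩ h
    rcases m with _ | m
    · have : ¬ k - i = 0 := fun h' => h (by simp; omega)
      simp [mulTerm, coeff_one, this]
    · have : ((D : R →ₗ[C] R) ^ (m + 1)) (if k - i + (m + 1 : ℕ) = 0 then (1 : R) else 0) = 0 := by
        split_ifs
        · simp [pow_succ]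
        · simp
      simp only [mulTerm, coeff_one, this, mul_zero, smul_zero]

theorem mul_add' (A B E : PseudoDiffOp D) : A * (B + E) = A * B + A * E := by
  ext k
  rw [coeff_add, coeff_mul, coeff_mul, coeff_mul,
    ← finsum_add_distrib (mulTerm_finite _ _ _) (mulTerm_finite _ _ _)]
  exact finsum_congr fun p => by simp [mulTerm, mul_add, smul_add]

theorem add_mul' (A B E : PseudoDiffOp D) : (A + B) * E = A * E + B * E := by
  ext k
  rw [coeff_add, coeff_mul, coeff_mul, coeff_mul,
    ← finsum_add_distrib (mulTerm_finite _ _ _) (mulTerm_finite _ _ _)]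
  exact finsum_congr fun p => by simp [mulTerm, add_mul, smul_add]

/-- The general term of a triple product. -/
noncomputable def tripleTerm (A B E : PseudoDiffOp D) (k : ℤ) (z : ℤ × ℤ × ℕ × ℕ × ℕ) : R :=
  (Ring.choose z.1 (z.2.2.1 + z.2.2.2.1) * ((z.2.2.1 + z.2.2.2.1).choose z.2.2.1 : ℤ) *
      Ring.choose z.2.1 z.2.2.2.2) •
    (A.coeff z.1 * ((D : R →ₗ[C] R) ^ z.2.2.1) (B.coeff z.2.1) *
      ((D : R →ₗ[C] R) ^ (z.2.2.2.1 + z.2.2.2.2))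
        (E.coeff (k - z.1 - z.2.1 + z.2.2.1 + z.2.2.2.1 + z.2.2.2.2)))

theorem tripleTerm_finite (A B E : PseudoDiffOp D) (k : ℤ) :
    (tripleTerm A B E k).HasFiniteSupport := by
  obtain ⟨M, hM⟩ := A.bddAbove'
  obtain ⟨N, hN⟩ := B.bddAbove'
  obtain ⟨P, hP⟩ := E.bddAbove'
  have hs := Set.finite_Iic (M + N + P - k).toNat
  refine Set.Finite.subset ((Set.finite_Icc (k - N - P) M).prod
    ((Set.finite_Icc (k - M - P) N).prod (hs.prod (hs.prod hs)))) ?_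
  rintro ⟨i, j, m, r, t⟩ h
  have h1 : i ≤ M := by
    by_contra hc
    exact h (by simp [tripleTerm, hM i (by omega)])
  have h2 : j ≤ N := by
    by_contra hc
    exact h (by simp [tripleTerm, hN j (by omega)])
  have h3 : k - i - j + m + r + t ≤ P := by
    by_contra hc
    exact h (by simp [tripleTerm, hP (k - i - j + m + r + t) (by omega)])
  simp only [Set.mem_prod, Set.mem_Icc, Set.mem_Iic]
  omega

theorem coeff_mul_mul_left (A B E : PseudoDiffOp D) (k : ℤ) :
    ((A * B) * E).coeff k = ∑ᶠ z, tripleTerm A B E k z := by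
  classical
  rw [finsum_eq_finsum_fiber (tripleTerm_finite A B E k)
    (fun z => ((z.1 + z.2.1 - z.2.2.1, z.2.2.2.1 + z.2.2.2.2), (z.1, z.2.2.1)))
    (fun x => (Finset.HasAntidiagonal.antidiagonal x.1.2).image
      fun p => (x.2.1, x.1.1 - x.2.1 + x.2.2, x.2.2, p.1, p.2))]
  swap
  · rintro ⟨⟨q, p⟩, ⟨i', m'⟩⟩ ⟨i, j, m, r, t⟩
    simp only [Finset.mem_image, Finset.HasAntidiagonal.mem_antidiagonal, Prod.mk.injEq, Prod.exists]
    constructor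
    · rintro ⟨r', t', h, rfl, rfl, rfl, rfl, rfl⟩
      refine ⟨⟨by omega, h⟩, rfl, rfl⟩
    · rintro ⟨⟨h1, h2⟩, rfl, rfl⟩
      exact ⟨r, t, h2, rfl, by omega, rfl, rfl, rfl⟩
  have hterm : ∀ x : (ℤ × ℕ) × (ℤ × ℕ),
      ∑ y ∈ (Finset.HasAntidiagonal.antidiagonal x.1.2).image
        (fun p => (x.2.1, x.1.1 - x.2.1 + x.2.2, x.2.2, p.1, p.2)), tripleTerm A B E k y =
      Ring.choose x.1.1 x.1.2 • (mulTerm A B x.1.1 x.2 *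
        ((D : R →ₗ[C] R) ^ x.1.2) (E.coeff (k - x.1.1 + x.1.2))) := by
    rintro ⟨⟨q, p⟩, ⟨i, m⟩⟩
    rw [Finset.sum_image (by rintro ⟨a, b⟩ _ ⟨c, d⟩ _ h; simpa using h)]
    simp only [tripleTerm, mulTerm]
    have hv : Ring.choose q p * Ring.choose i m =
        ∑ y ∈ Finset.HasAntidiagonal.antidiagonal p, Ring.choose i (m + y.1) * ((m + y.1).choose m : ℤ) *
          Ring.choose (q - i + m) y.2 := by
      rw [show q = (i - m) + (q - i + m) by ring, Ring.add_choose_eq _ (Commute.all _ _),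
        Finset.sum_mul]
      refine Finset.sum_congr rfl fun y _ => ?_
      have := Ring.choose_smul_choose i (n := m + y.1) (k := m) (by omega)
      rw [Nat.add_sub_cancel_left, nsmul_eq_mul] at this
      rw [mul_comm (Ring.choose i (m + y.1)), this]
      rw [show i - m + (q - i + m) - i + m = q - i + m by ring]
      ring
    rw [smul_mul_assoc, smul_smul, hv, Finset.sum_smul]
    refine Finset.sum_congr rfl fun y hy => ?_
    rw [← Finset.HasAntidiagonal.mem_antidiagonal.1 hy,
      show k - i - (q - i + m) + m + y.1 + y.2 = k - q + ((y.1 + y.2 : ℕ) : ℤ) by push_cast; ring]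
  simp_rw [hterm]
  rw [coeff_mul]
  refine Eq.trans ?_ (finsum_curry _ ?_).symm
  · refine finsum_congr fun x => ?_
    dsimp only
    rw [mulTerm, coeff_mul, finsum_mul' _ _ (mulTerm_finite _ _ _), smul_finsum' _ ?_]
    exact (mulTerm_finite A B x.1).subset fun y hy => left_ne_zero_of_mul hy
  · obtain ⟨M, hM⟩ := A.bddAbove'
    obtain ⟨N, hN⟩ := B.bddAbove'
    obtain ⟨P, hP⟩ := E.bddAbove'
    have hs := Set.finite_Iic (M + N + P - k).toNat
    refine Set.Finite.subset (((Set.finite_Icc (k - P) (M + N)).prod hs).prod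
      ((Set.finite_Icc (k - P - N) M).prod hs)) ?_
    rintro ⟨⟨q, p⟩, ⟨i, m⟩⟩ h
    have h1 : i ≤ M := by
      by_contra hc
      exact h (by simp [mulTerm, hM i (by omega)])
    have h2 : q - i + m ≤ N := by
      by_contra hc
      exact h (by simp [mulTerm, hN (q - i + m) (by omega)])
    have h3 : k - q + p ≤ P := by
      by_contra hc
      exact h (by simp [hP (k - q + p) (by omega)])
    simp only [Set.mem_prod, Set.mem_Icc, Set.mem_Iic]
    omega

theorem coeff_mul_mul_right (A B E : PseudoDiffOp D) (k : ℤ) :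
    (A * (B * E)).coeff k = ∑ᶠ z, tripleTerm A B E k z := by
  classical
  rw [finsum_eq_finsum_fiber (tripleTerm_finite A B E k)
    (fun z => ((z.1, z.2.2.1 + z.2.2.2.1), (z.2.1, z.2.2.2.2)))
    (fun x => (Finset.HasAntidiagonal.antidiagonal x.1.2).image
      fun p => (x.1.1, x.2.1, p.1, p.2, x.2.2))]
  swap
  · rintro ⟨⟨i', s⟩, ⟨j', t'⟩⟩ ⟨i, j, m, r, t⟩
    simp only [Finset.mem_image, Finset.HasAntidiagonal.mem_antidiagonal, Prod.mk.injEq, Prod.exists]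
    constructor
    · rintro ⟨r', t', h, rfl, rfl, rfl, rfl, rfl⟩
      exact ⟨⟨rfl, h⟩, rfl, rfl⟩
    · rintro ⟨⟨rfl, h2⟩, rfl, rfl⟩
      exact ⟨m, r, h2, rfl, rfl, rfl, rfl, rfl⟩
  have hterm : ∀ x : (ℤ × ℕ) × (ℤ × ℕ),
      ∑ y ∈ (Finset.HasAntidiagonal.antidiagonal x.1.2).image
        (fun p => (x.1.1, x.2.1, p.1, p.2, x.2.2)), tripleTerm A B E k y =
      Ring.choose x.1.1 x.1.2 • (A.coeff x.1.1 *
        ((D : R →ₗ[C] R) ^ x.1.2) (mulTerm B E (k - x.1.1 + x.1.2) x.2)) := by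
    rintro ⟨⟨i, s⟩, ⟨j, t⟩⟩
    rw [Finset.sum_image (by rintro ⟨a, b⟩ _ ⟨c, d⟩ _ h; simpa using h)]
    simp only [tripleTerm, mulTerm]
    rw [map_zsmul, Derivation.pow_leibniz, mul_smul_comm, smul_smul, Finset.mul_sum,
      Finset.smul_sum]
    refine Finset.sum_congr rfl fun y hy => ?_
    have hs := Finset.HasAntidiagonal.mem_antidiagonal.1 hy
    rw [← Module.End.mul_apply, ← pow_add, ← hs, mul_smul_comm, ← natCast_zsmul, smul_smul,
      mul_assoc (A.coeff i)]
    rw [show k - i - j + y.1 + y.2 + t = k - i + ((y.1 + y.2 : ℕ) : ℤ) - j + t by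
      push_cast; ring]
    congr 1
    ring
  simp_rw [hterm]
  rw [coeff_mul]
  refine Eq.trans ?_ (finsum_curry _ ?_).symm
  · refine finsum_congr fun x => ?_
    dsimp only
    have hf := mulTerm_finite B E (k - x.1 + x.2)
    have hf1 : (fun y => ((D : R →ₗ[C] R) ^ x.2)
        (mulTerm B E (k - x.1 + x.2) y)).HasFiniteSupport :=
      Set.Finite.subset hf fun y hy h0 => hy (by simp only [h0, map_zero])
    rw [mulTerm, coeff_mul, map_finsum _ hf, mul_finsum' _ _ hf1, smul_finsum' _ ?_]
    exact Set.Finite.subset hf1 fun y hy => right_ne_zero_of_mul hy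
  · obtain ⟨M, hM⟩ := A.bddAbove'
    obtain ⟨N, hN⟩ := B.bddAbove'
    obtain ⟨P, hP⟩ := E.bddAbove'
    have hs := Set.finite_Iic (M + N + P - k).toNat
    refine Set.Finite.subset (((Set.finite_Icc (k - N - P) M).prod hs).prod
      ((Set.finite_Icc (k - M - P) N).prod hs)) ?_
    rintro ⟨⟨i, s⟩, ⟨j, t⟩⟩ h
    have h1 : i ≤ M := by
      by_contra hc
      exact h (by simp [hM i (by omega)])
    have h2 : j ≤ N := by
      by_contra hc
      exact h (by simp [mulTerm, hN j (by omega)])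
    have h3 : k - i + s - j + t ≤ P := by
      by_contra hc
      exact h (by simp [mulTerm, hP (k - i + s - j + t) (by omega)])
    simp only [Set.mem_prod, Set.mem_Icc, Set.mem_Iic]
    omega

noncomputable instance : Ring (PseudoDiffOp D) where
  __ := (inferInstance : AddCommGroup (PseudoDiffOp D))
  left_distrib := mul_add'
  right_distrib := add_mul'
  zero_mul A := by
    ext k
    rw [coeff_mul]
    exact finsum_eq_zero_of_forall_eq_zero fun p => by simp [mulTerm]
  mul_zero A := by
    ext k
    rw [coeff_mul]
    exact finsum_eq_zero_of_forall_eq_zero fun p => by simp [mulTerm]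
  mul_assoc A B E := by
    ext k
    rw [coeff_mul_mul_left, coeff_mul_mul_right]
  one_mul := one_mul'
  mul_one := mul_one'

noncomputable instance : Algebra C (PseudoDiffOp D) :=
  Algebra.ofModule
    (fun c A B => by
      ext k
      rw [coeff_smul, coeff_mul, coeff_mul, smul_finsum' _ (mulTerm_finite _ _ _)]
      exact finsum_congr fun p => by
        simp only [mulTerm, coeff_smul, smul_mul_assoc, smul_comm c])
    (fun c A B => by
      ext k
      rw [coeff_smul, coeff_mul, coeff_mul, smul_finsum' _ (mulTerm_finite _ _ _)]
      exact finsum_congr fun p => by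
        simp only [mulTerm, coeff_smul, map_smul, mul_smul_comm, smul_comm c])

open Classical in
/-- The order of an operator: the largest `i` whose coefficient is nonzero, and `⊥` (that is,
`-∞`) for the zero operator. -/
noncomputable def ord (A : PseudoDiffOp D) : WithBot ℤ :=
  if A = 0 then ⊥ else ((sSup {i : ℤ | A.coeff i ≠ 0} : ℤ) : WithBot ℤ)

theorem coeff_eq_zero_of_ord_lt {A : PseudoDiffOp D} {i : ℤ} (h : A.ord < i) :
    A.coeff i = 0 := by
  by_contra hc
  have hA : A ≠ 0 := fun h0 => hc (by simp [h0])
  rw [ord, if_neg hA, WithBot.coe_lt_coe] at h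
  obtain ⟨N, hN⟩ := A.bddAbove'
  have hb : BddAbove {i : ℤ | A.coeff i ≠ 0} :=
    ⟨N, fun j hj => by by_contra hlt; exact hj (hN j (by omega))⟩
  exact absurd (le_csSup hb hc) (not_le.2 h)

theorem ord_le_iff {A : PseudoDiffOp D} {m : ℤ} :
    A.ord ≤ m ↔ ∀ i, m < i → A.coeff i = 0 := by
  constructor
  · exact fun h i hi => coeff_eq_zero_of_ord_lt (h.trans_lt (WithBot.coe_lt_coe.2 hi))
  · intro h
    by_cases hA : A = 0
    · simp [ord, hA]
    · rw [ord, if_neg hA, WithBot.coe_le_coe]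
      have hne : {i : ℤ | A.coeff i ≠ 0}.Nonempty := by
        by_contra hc
        refine hA (PseudoDiffOp.ext (funext fun i => ?_))
        by_contra hi
        exact hc ⟨i, hi⟩
      exact csSup_le hne fun i hi => by
        by_contra hlt
        exact hi (h i (by omega))

/-- The leading coefficient (`0` for the zero operator). -/
noncomputable def leadingCoeff (A : PseudoDiffOp D) : R :=
  A.coeff (A.ord.unbotD 0)

def IsMonic (A : PseudoDiffOp D) : Prop :=
  A.leadingCoeff = 1

/-- Normal form: monic, and the coefficient just below the leading one vanishes. -/
def IsNormalForm (A : PseudoDiffOp D) : Prop :=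
  A.IsMonic ∧ A.coeff (A.ord.unbotD 0 - 1) = 0

/-- `A` is a differential operator, i.e. an element of `R[∂] ⊆ R((∂⁻¹))`. -/
def IsDiffOp (A : PseudoDiffOp D) : Prop :=
  ∀ i < 0, A.coeff i = 0

/-- The positive part `A₊ = ∑_{i ≥ 0} aᵢ ∂ⁱ`. -/
def posPart (A : PseudoDiffOp D) : PseudoDiffOp D where
  coeff i := if 0 ≤ i then A.coeff i else 0
  bddAbove' := by
    obtain ⟨N, hN⟩ := A.bddAbove'
    exact ⟨N, fun i hi => by simp [hN i hi]⟩

/-- `Q` is a monic `n`-th root of `L`: a pseudo-differential operator `∂ + q₀ + q₋₁ ∂⁻¹ + ⋯`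
with `Qⁿ = L`. -/
def IsMonicRoot (n : ℕ) (L Q : PseudoDiffOp D) : Prop :=
  Q.ord = 1 ∧ Q.IsMonic ∧ Q ^ n = L

theorem ord_add_two_le_iff {A L : PseudoDiffOp D} :
    A.ord + 2 ≤ L.ord ↔ ∀ i : ℤ, L.ord < i + 2 → A.coeff i = 0 := by
  by_cases hL : L = 0
  · subst hL
    have h0 : (0 : PseudoDiffOp D).ord = ⊥ := by simp [ord]
    rw [h0]
    constructor
    · intro h i _
      refine coeff_eq_zero_of_ord_lt ?_
      have : A.ord = ⊥ := by
        cases hA : A.ord with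
        | bot => rfl
        | coe a => rw [hA] at h; exact absurd h (by exact WithBot.not_coe_le_bot (a + 2))
      rw [this]
      exact WithBot.bot_lt_coe i
    · intro h
      have : A = 0 := PseudoDiffOp.ext (funext fun i => h i (WithBot.bot_lt_coe (i + 2)))
      simp [this, h0]
  · obtain ⟨l, hl⟩ : ∃ l : ℤ, L.ord = l := ⟨_, by rw [ord, if_neg hL]⟩
    rw [hl]
    have h1 : A.ord + 2 ≤ (l : WithBot ℤ) ↔ A.ord ≤ ((l - 2 : ℤ) : WithBot ℤ) := by
      cases A.ord with
      | bot => simp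
      | coe a =>
        rw [show ((a : WithBot ℤ) + 2) = ((a + 2 : ℤ) : WithBot ℤ) from rfl,
          WithBot.coe_le_coe, WithBot.coe_le_coe]
        omega
    rw [h1, ord_le_iff]
    refine forall_congr' fun i => ?_
    rw [show ((i : WithBot ℤ) + 2) = ((i + 2 : ℤ) : WithBot ℤ) from rfl, WithBot.coe_lt_coe]
    exact ⟨fun h hi => h (by omega), fun h hi => h (by omega)⟩

/-- The `C`-vector space `W(L)` of the differential operators `A ∈ R[∂]` that almost commute with
`L`: the order of `[L, A] = L A - A L` is at most `ord L - 2`. -/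
noncomputable def almostCommuting (L : PseudoDiffOp D) : Submodule C (PseudoDiffOp D) where
  carrier := {A | A.IsDiffOp ∧ (L * A - A * L).ord + 2 ≤ L.ord}
  zero_mem' := ⟨fun _ _ => rfl, by
    rw [ord_add_two_le_iff]
    intro i _
    simp⟩
  add_mem' := by
    rintro A B ⟨hA, hA'⟩ ⟨hB, hB'⟩
    refine ⟨fun i hi => by simp [hA i hi, hB i hi], ?_⟩
    rw [ord_add_two_le_iff] at *
    intro i hi
    rw [show L * (A + B) - (A + B) * L = (L * A - A * L) + (L * B - B * L) by noncomm_ring,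
      coeff_add, hA' i hi, hB' i hi, add_zero]
  smul_mem' := by
    rintro c A ⟨hA, hA'⟩
    refine ⟨fun i hi => by simp [hA i hi], ?_⟩
    rw [ord_add_two_le_iff] at *
    intro i hi
    rw [mul_smul_comm, smul_mul_assoc, ← smul_sub, coeff_smul, hA' i hi, smul_zero]

end PseudoDiffOp

/-- The differential variables `u_ℓ^{(k)}`, `2 ≤ ℓ ≤ n`, `k ≥ 0`, as pairs `(ℓ, k)`. -/
abbrev DiffVar (n : ℕ) : Type := Set.Icc 2 n × ℕ

/-- The ring of differential polynomials `C{u₂, …, uₙ}`. -/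
abbrev DiffPoly (n : ℕ) (C : Type*) [CommRing C] : Type _ := MvPolynomial (DiffVar n) C

namespace DiffPoly

variable (n : ℕ) (C : Type*) [CommRing C]

/-- The derivation of `C{u₂, …, uₙ}`: it vanishes on `C` and sends `u_ℓ^{(k)}` to
`u_ℓ^{(k+1)}`. -/
noncomputable def der : Derivation C (DiffPoly n C) (DiffPoly n C) :=
  MvPolynomial.mkDerivation C fun v => MvPolynomial.X (v.1, v.2 + 1)

/-- The weight `w(u_ℓ^{(k)}) = ℓ + k`. -/
def weight (v : DiffVar n) : ℤ := (v.1 : ℕ) + v.2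

variable {n C}

/-- An operator is homogeneous of weight `r` if the coefficient of `∂ⁱ` is homogeneous of weight
`r - i` for every `i`. -/
def IsHomogeneousOp (P : PseudoDiffOp (der n C)) (r : ℤ) : Prop :=
  ∀ i : ℤ, MvPolynomial.IsWeightedHomogeneous (weight n) (P.coeff i) (r - i)

variable (n C)

/-- The formal operator `L = ∂ⁿ + u₂ ∂^{n-2} + ⋯ + u_{n-1} ∂ + uₙ`. -/
noncomputable def formalL : PseudoDiffOp (der n C) :=
  PseudoDiffOp.single _ n 1 +
    ∑ l : Set.Icc 2 n, PseudoDiffOp.single _ ((n : ℤ) - (l : ℕ)) (MvPolynomial.X (l, 0))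

end DiffPoly

/-!
Everything is read off from leading coefficients: the coefficient of `∂^(a+b)` in a product of
operators of orders `a` and `b` is the product of the leading coefficients, and the next one is
corrected by the derivative of the second factor.

* If `Q` is monic of order `1`, changing its coefficient of `∂^(-k)` by `q` changes the coefficient
  of `∂^(n-1-k)` in `Qⁿ` by `n q`, so the coefficients of an `n`-th root of `L` are determined one
  after the other, by formulas that respect the grading.
* `Q` commutes with `L = Qⁿ`, so `[L, P_j] = -[L, Q^j - P_j]`, which has order at most `n - 2`
  because `Q^j - P_j` has order at most `-1`.
* For `A ∈ W(L)` of order `j` with leading coefficient `a`, the coefficient of `∂^(n+j-1)` in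
  `[L, A]` is `n a'`. Hence `a` is constant, and subtracting `a P_j` lowers the order.
* The `P_j` lie in distinct homogeneous components, which are independent, so a homogeneous basis
  agrees with them up to units.
-/

theorem pow_succ_sub_pow_succ {A : Type*} [Ring A] (a b : A) (n : ℕ) :
    a ^ (n + 1) - b ^ (n + 1) = a ^ n * (a - b) + (a ^ n - b ^ n) * b := by
  rw [pow_succ, pow_succ, mul_sub, sub_mul, sub_add_sub_cancel]

theorem pow_apply_mem_of_forall_apply_mem {ι K M : Type*} [AddMonoid ι] [Semiring K]
    [AddCommMonoid M] [Module K M] {f : Module.End K M} {V : ι → Submodule K M} {d : ι}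
    (hf : ∀ r, ∀ x ∈ V r, f x ∈ V (r + d)) {r : ι} {x : M} (hx : x ∈ V r) (m : ℕ) :
    (f ^ m) x ∈ V (r + m • d) := by
  induction m with
  | zero => simpa using hx
  | succ m ih =>
    rw [pow_succ', Module.End.mul_apply, succ_nsmul, ← add_assoc]
    exact hf _ _ ih

section IndependentSubmodules

variable {ι K M : Type*} [Ring K] [AddCommGroup M] [Module K M]
  {V : ι → Submodule K M} {W : Submodule K M}

theorem repr_smul_eq_of_iSupIndep (hV : iSupIndep V) (b : Module.Basis ι K W)
    (hb : ∀ j, (b j : M) ∈ V j) {j : ι} {x : W} (hx : (x : M) ∈ V j) :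
    b.repr x j • b j = x := by
  classical
  have hdiff : x - b.repr x j • b j = Finsupp.linearCombination K b ((b.repr x).erase j) := by
    rw [sub_eq_iff_eq_add', ← Finsupp.linearCombination_single, ← map_add,
      Finsupp.single_add_erase, b.linearCombination_repr]
  have hmem : ((x - b.repr x j • b j : W) : M) ∈ V j :=
    sub_mem hx (Submodule.smul_mem _ _ (hb j))
  have hmem' : ((x - b.repr x j • b j : W) : M) ∈ ⨆ i, ⨆ _ : i ≠ j, V i := by
    rw [hdiff, Finsupp.linearCombination_apply, Finsupp.sum, Submodule.coe_sum]
    refine sum_mem fun i hi => Submodule.smul_mem _ _ ?_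
    have hij : i ≠ j := by
      rw [Finsupp.support_erase] at hi
      exact Finset.ne_of_mem_erase hi
    exact le_iSup₂ (f := fun i (_ : i ≠ j) => V i) i hij (hb i)
  exact (sub_eq_zero.1 (Subtype.ext (Submodule.disjoint_def.1 (hV j) _ hmem hmem'))).symm

theorem exists_units_smul_eq_of_iSupIndep (hV : iSupIndep V) (b T : Module.Basis ι K W)
    (hb : ∀ j, (b j : M) ∈ V j) (hT : ∀ j, (T j : M) ∈ V j) :
    ∃ c : ι → Kˣ, ∀ j, T j = (c j : K) • b j := by
  have hbT j : b.repr (T j) j • b j = T j := repr_smul_eq_of_iSupIndep hV b hb (hT j)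
  have hTb j : T.repr (b j) j • T j = b j := repr_smul_eq_of_iSupIndep hV T hT (hb j)
  have eq_one_of_smul_eq (b₁ : Module.Basis ι K W) (j : ι) (c : K)
      (h : c • b₁ j = b₁ j) : c = 1 := by
    simpa using DFunLike.congr_fun (congrArg b₁.repr h) j
  exact ⟨fun j => ⟨b.repr (T j) j, T.repr (b j) j,
    eq_one_of_smul_eq T j _ (by rw [mul_smul, hTb, hbT]),
    eq_one_of_smul_eq b j _ (by rw [mul_smul, hbT, hTb])⟩, fun j => (hbT j).symm⟩

end IndependentSubmodules

section MvPolynomial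

open MvPolynomial

variable {σ A M : Type*} [CommSemiring A]

theorem exists_C_eq_of_forall_pderiv_eq_zero [IsAddTorsionFree A] {p : MvPolynomial σ A}
    (hp : ∀ v, pderiv v p = 0) : ∃ a, C a = p := by
  classical
  refine ⟨p.coeff 0, MvPolynomial.ext _ _ fun s => ?_⟩
  rw [coeff_C]
  split_ifs with hs
  · rw [hs]
  · obtain ⟨v, hv⟩ := Finsupp.ne_iff.1 (Ne.symm hs)
    have h := coeff_pderiv (i := v) p (s - Finsupp.single v 1)
    rw [hp, MvPolynomial.coeff_zero, Finsupp.sub_add_single_one_cancel hv, ← Nat.cast_succ,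
      mul_comm, ← nsmul_eq_mul] at h
    exact ((smul_eq_zero_iff_right (Nat.succ_ne_zero _)).1 h.symm).symm

theorem isWeightedHomogeneous_mkDerivation [AddCommMonoid M] {w : σ → M} {d m : M}
    {f : σ → MvPolynomial σ A} (hf : ∀ v, IsWeightedHomogeneous w (f v) (w v + d))
    {p : MvPolynomial σ A} (hp : IsWeightedHomogeneous w p m) :
    IsWeightedHomogeneous w (mkDerivation A f p) (m + d) := by
  induction hp using IsWeightedHomogeneous.induction_on with
  | zero => rw [map_zero]; exact isWeightedHomogeneous_zero _ _ _
  | add p q _ _ hp hq => rw [map_add]; exact hp.add hq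
  | monomial s c hs =>
    rw [mkDerivation_monomial, smul_eq_C_mul]
    refine IsWeightedHomogeneous.C_mul (IsWeightedHomogeneous.sum _ _ _ fun v hv => ?_) _
    have hmul := (isWeightedHomogeneous_monomial w (s - Finsupp.single v 1) (s v : A) rfl).mul
      (hf v)
    rwa [← add_assoc, Finsupp.weight_sub_single_add (Finsupp.mem_support_iff.1 hv), hs] at hmul

theorem iSupIndep_weightedHomogeneousSubmodule [AddCommMonoid M] (w : σ → M) :
    iSupIndep (weightedHomogeneousSubmodule A w) := by
  classical
  let := weightedDecomposition A w
  exact (DirectSum.Decomposition.isInternal _).submodule_iSupIndep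

end MvPolynomial

namespace PseudoDiffOp

variable {C R : Type*} [CommRing C] [CommRing R] [Algebra C R] {D : Derivation C R R}

section Order

/-- The operators of order at most `m`, as a term of the order filtration. -/
def ordLE (D : Derivation C R R) (m : ℤ) : Submodule C (PseudoDiffOp D) where
  carrier := {A | ∀ i, m < i → A.coeff i = 0}
  zero_mem' _ _ := rfl
  add_mem' hA hB i hi := by rw [coeff_add, hA i hi, hB i hi, add_zero]
  smul_mem' c A hA i hi := by rw [coeff_smul, hA i hi, smul_zero]

variable {a b m : ℤ} {A B : PseudoDiffOp D}

theorem mem_ordLE_iff_ord_le : A ∈ ordLE D m ↔ A.ord ≤ m := ord_le_iff.symm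

theorem ordLE_mono (h : a ≤ b) : ordLE D a ≤ ordLE D b :=
  fun _ hA i hi => hA i (h.trans_lt hi)

theorem mem_ordLE_sub_one (hA : A ∈ ordLE D m) (h : A.coeff m = 0) : A ∈ ordLE D (m - 1) := by
  intro i hi
  rcases eq_or_lt_of_le (show m ≤ i by omega) with rfl | hmi
  · exact h
  · exact hA i hmi

theorem eq_zero_of_forall_mem_ordLE (c : ℤ) (h : ∀ k : ℕ, A ∈ ordLE D (c - k)) : A = 0 := by
  ext i
  exact h (c - i + 1).toNat i (by omega)

theorem single_mem_ordLE (i : ℤ) (r : R) : single D i r ∈ ordLE D i :=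
  fun _ hk => if_neg hk.ne'

theorem coeff_mul_sub_one (hA : A ∈ ordLE D a) (hB : B ∈ ordLE D b) :
    (A * B).coeff (a + b - 1) =
      A.coeff a * B.coeff (b - 1) + A.coeff (a - 1) * B.coeff b
        + a • (A.coeff a * D (B.coeff b)) := by
  classical
  rw [coeff_mul, finsum_eq_sum_of_support_subset
    (s := {((a, 0) : ℤ × ℕ), (a - 1, 0), (a, 1)})]
  · rw [Finset.sum_insert (by grind), Finset.sum_insert (by simp), Finset.sum_singleton]
    simp only [mulTerm, Ring.choose_zero_right, Ring.choose_one_right, one_smul, pow_zero, pow_one,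
      Module.End.one_apply, Nat.cast_zero, Nat.cast_one, add_zero, Derivation.coeFn_coe, add_assoc]
    rw [show a + b - 1 - a = b - 1 by ring, show a + b - 1 - (a - 1) = b by ring, sub_add_cancel]
  · rintro ⟨i, s⟩ hne
    have hi : i ≤ a := by
      by_contra hlt
      exact hne (by simp [mulTerm, hA i (by omega)])
    have hs : a + b - 1 - i + s ≤ b := by
      by_contra hlt
      exact hne (by simp [mulTerm, hB (a + b - 1 - i + s) (by omega)])
    simp only [Finset.coe_insert, Finset.coe_singleton, Set.mem_insert_iff, Set.mem_singleton_iff,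
      Prod.mk.injEq]
    omega

theorem coeff_mul_add (hA : A ∈ ordLE D a) (hB : B ∈ ordLE D b) :
    (A * B).coeff (a + b) = A.coeff a * B.coeff b := by
  have h := coeff_mul_sub_one hA (ordLE_mono (show b ≤ b + 1 by omega) hB)
  rw [hB (b + 1) (by omega)] at h
  simpa [← add_assoc] using h

theorem mul_mem_ordLE (hA : A ∈ ordLE D a) (hB : B ∈ ordLE D b) : A * B ∈ ordLE D (a + b) := by
  intro i hi
  have h := coeff_mul_add (ordLE_mono (show a ≤ i - b by omega) hA) hB
  rwa [sub_add_cancel, hA (i - b) (by omega), zero_mul] at h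

theorem commutator_mem_ordLE (hA : A ∈ ordLE D a) (hB : B ∈ ordLE D b) :
    A * B - B * A ∈ ordLE D (a + b - 1) := by
  refine mem_ordLE_sub_one
    (sub_mem (mul_mem_ordLE hA hB) (add_comm a b ▸ mul_mem_ordLE hB hA)) ?_
  rw [coeff_sub, coeff_mul_add hA hB, add_comm a b, coeff_mul_add hB hA, mul_comm, sub_self]

theorem coeff_commutator (hA : A ∈ ordLE D a) (hB : B ∈ ordLE D b) :
    (A * B - B * A).coeff (a + b - 1) =
      a • (A.coeff a * D (B.coeff b)) - b • (B.coeff b * D (A.coeff a)) := by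
  rw [coeff_sub, coeff_mul_sub_one hA hB, add_comm a b, coeff_mul_sub_one hB hA]
  ring

theorem exists_forall_sub_mem_ordLE {F : ℕ → PseudoDiffOp D}
    (hF : ∀ k : ℕ, F (k + 1) - F k ∈ ordLE D (-k)) :
    ∃ A, ∀ k : ℕ, A - F k ∈ ordLE D (-k) := by
  have cauchy {j k : ℕ} (hjk : j ≤ k) : F k - F j ∈ ordLE D (-j) := by
    induction k, hjk using Nat.le_induction with
    | base => rw [sub_self]; exact zero_mem _
    | succ k hjk ih =>
      rw [← sub_add_sub_cancel _ (F k)]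
      exact add_mem (ordLE_mono (by omega) (hF k)) ih
  obtain ⟨N, hN⟩ := (F 0).bddAbove'
  refine ⟨⟨fun i => (F (1 - i).toNat).coeff i, max N 1, fun i hi => ?_⟩, fun k i hi => ?_⟩
  · obtain ⟨hNi, hi⟩ := max_lt_iff.1 hi
    rw [Int.toNat_eq_zero.2 (by omega), hN i hNi]
  · have h := cauchy (show (1 - i).toNat ≤ k by omega) i (by omega)
    rw [coeff_sub, sub_eq_zero] at h ⊢
    exact h.symm

end Order

section Monic

/-- `A` has the form `∂ᵐ + lower order terms`. Over a nontrivial ring this says that `A` is monic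
and has order `m`, see `isMonicOfOrder_iff`. -/
structure IsMonicOfOrder (A : PseudoDiffOp D) (m : ℤ) : Prop where
  mem_ordLE : A ∈ ordLE D m
  coeff_eq_one : A.coeff m = 1

namespace IsMonicOfOrder

variable {a b m e : ℤ} {A B : PseudoDiffOp D}

theorem ord_eq [Nontrivial R] (hA : A.IsMonicOfOrder m) : A.ord = m :=
  le_antisymm (mem_ordLE_iff_ord_le.1 hA.mem_ordLE) <| not_lt.1 fun hlt =>
    one_ne_zero (hA.coeff_eq_one.symm.trans (coeff_eq_zero_of_ord_lt hlt))

theorem isMonic [Nontrivial R] (hA : A.IsMonicOfOrder m) : A.IsMonic := by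
  rw [IsMonic, leadingCoeff, hA.ord_eq]
  exact hA.coeff_eq_one

theorem isNormalForm_iff [Nontrivial R] (hA : A.IsMonicOfOrder m) :
    A.IsNormalForm ↔ A.coeff (m - 1) = 0 := by
  rw [IsNormalForm, hA.ord_eq, and_iff_right hA.isMonic, WithBot.unbotD_coe]

theorem sub_mem_ordLE (hA : A.IsMonicOfOrder m) (hB : B.IsMonicOfOrder m) :
    A - B ∈ ordLE D (m - 1) :=
  mem_ordLE_sub_one (sub_mem hA.mem_ordLE hB.mem_ordLE)
    (by rw [coeff_sub, hA.coeff_eq_one, hB.coeff_eq_one, sub_self])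

theorem of_sub_mem_ordLE (hB : B.IsMonicOfOrder m) (h : A - B ∈ ordLE D (m - 1)) :
    A.IsMonicOfOrder m where
  mem_ordLE := by
    rw [← sub_add_cancel A B]
    exact add_mem (ordLE_mono (by omega) h) hB.mem_ordLE
  coeff_eq_one := by
    rw [← sub_add_cancel A B, coeff_add, h m (by omega), hB.coeff_eq_one, zero_add]

theorem single_one (m : ℤ) : (single D m 1).IsMonicOfOrder m :=
  ⟨single_mem_ordLE m 1, if_pos rfl⟩

theorem mul (hA : A.IsMonicOfOrder a) (hB : B.IsMonicOfOrder b) :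
    (A * B).IsMonicOfOrder (a + b) where
  mem_ordLE := mul_mem_ordLE hA.mem_ordLE hB.mem_ordLE
  coeff_eq_one := by
    rw [coeff_mul_add hA.mem_ordLE hB.mem_ordLE, hA.coeff_eq_one, hB.coeff_eq_one, one_mul]

theorem pow (hA : A.IsMonicOfOrder 1) (n : ℕ) : (A ^ n).IsMonicOfOrder n := by
  induction n with
  | zero => exact single_one 0
  | succ n ih => rw [pow_succ, Nat.cast_succ]; exact ih.mul hA

theorem coeff_pow_sub_one (hA : A.IsMonicOfOrder 1) (n : ℕ) :
    (A ^ n).coeff (n - 1) = n • A.coeff 0 := by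
  induction n with
  | zero => simp [coeff_one]
  | succ n ih =>
    rw [pow_succ, Nat.cast_succ, coeff_mul_sub_one (hA.pow n).mem_ordLE hA.mem_ordLE, ih,
      hA.coeff_eq_one, (hA.pow n).coeff_eq_one, D.map_one_eq_zero, mul_zero, smul_zero, add_zero,
      one_mul, mul_one, sub_self, succ_nsmul']

theorem pow_sub_pow_mem_ordLE (hA : A.IsMonicOfOrder 1) (hB : B.IsMonicOfOrder 1)
    (h : A - B ∈ ordLE D e) (n : ℕ) : A ^ n - B ^ n ∈ ordLE D (n - 1 + e) := by
  induction n with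
  | zero => simp
  | succ n ih =>
    rw [pow_succ_sub_pow_succ, Nat.cast_succ, add_sub_cancel_right]
    refine add_mem (mul_mem_ordLE (hA.pow n).mem_ordLE h) ?_
    convert mul_mem_ordLE ih hB.mem_ordLE using 2
    ring

theorem coeff_pow_sub_pow (hA : A.IsMonicOfOrder 1) (hB : B.IsMonicOfOrder 1)
    (h : A - B ∈ ordLE D e) (n : ℕ) :
    (A ^ n - B ^ n).coeff (n - 1 + e) = n • (A - B).coeff e := by
  induction n with
  | zero => simp
  | succ n ih =>
    rw [pow_succ_sub_pow_succ, Nat.cast_succ, add_sub_cancel_right, coeff_add,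
      coeff_mul_add (hA.pow n).mem_ordLE h, (hA.pow n).coeff_eq_one, one_mul,
      show (n : ℤ) + e = n - 1 + e + 1 by ring,
      coeff_mul_add (hA.pow_sub_pow_mem_ordLE hB h n) hB.mem_ordLE, ih, hB.coeff_eq_one, mul_one,
      succ_nsmul']

end IsMonicOfOrder

theorem isMonicOfOrder_iff [Nontrivial R] {A : PseudoDiffOp D} {m : ℤ} :
    A.IsMonicOfOrder m ↔ A.ord = m ∧ A.IsMonic := by
  refine ⟨fun h => ⟨h.ord_eq, h.isMonic⟩, fun ⟨hord, hmonic⟩ =>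
    ⟨mem_ordLE_iff_ord_le.2 hord.le, ?_⟩⟩
  rwa [IsMonic, leadingCoeff, hord] at hmonic

theorem isMonicRoot_iff [Nontrivial R] {n : ℕ} {L Q : PseudoDiffOp D} :
    IsMonicRoot n L Q ↔ Q.IsMonicOfOrder 1 ∧ Q ^ n = L := by
  rw [isMonicOfOrder_iff, and_assoc]
  rfl

end Monic

section Root

/-- Successive approximations `∂ + q₀ + ⋯ + q_{1-k} ∂^{1-k}` of the `n`-th root of `L`. The step
from `k` to `k + 1` divides the leading error by `n`, so `Ring.inverse` is meaningful only when `n`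
is a unit. -/
noncomputable def rootApprox (n : ℕ) (L : PseudoDiffOp D) : ℕ → PseudoDiffOp D
  | 0 => single D 1 1
  | k + 1 => rootApprox n L k +
      single D (-k) (Ring.inverse (n : C) • (L - rootApprox n L k ^ n).coeff (n - 1 - k))

variable {n : ℕ} {L Q : PseudoDiffOp D}

theorem rootApprox_succ_sub (k : ℕ) :
    rootApprox n L (k + 1) - rootApprox n L k =
      single D (-k) (Ring.inverse (n : C) • (L - rootApprox n L k ^ n).coeff (n - 1 - k)) :=
  add_sub_cancel_left _ _

theorem rootApprox_succ_sub_mem_ordLE (k : ℕ) :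
    rootApprox n L (k + 1) - rootApprox n L k ∈ ordLE D (-k) := by
  rw [rootApprox_succ_sub]
  exact single_mem_ordLE _ _

theorem nsmul_coeff_rootApprox_succ_sub (hn : IsUnit (n : C)) (k : ℕ) :
    n • (rootApprox n L (k + 1) - rootApprox n L k).coeff (-k) =
      (L - rootApprox n L k ^ n).coeff (n - 1 - k) := by
  rw [rootApprox_succ_sub, coeff_single, if_pos rfl, ← Nat.cast_smul_eq_nsmul C, smul_smul,
    Ring.mul_inverse_cancel _ hn, one_smul]

theorem isMonicOfOrder_rootApprox (n : ℕ) (L : PseudoDiffOp D) (k : ℕ) :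
    (rootApprox n L k).IsMonicOfOrder 1 := by
  induction k with
  | zero => exact .single_one 1
  | succ k ih =>
    exact ih.of_sub_mem_ordLE (ordLE_mono (by omega) (rootApprox_succ_sub_mem_ordLE k))

theorem sub_rootApprox_pow_mem_ordLE (hn : IsUnit (n : C)) (hL : L.IsMonicOfOrder n) (k : ℕ) :
    L - rootApprox n L k ^ n ∈ ordLE D (n - 1 - k) := by
  induction k with
  | zero => simpa using hL.sub_mem_ordLE ((isMonicOfOrder_rootApprox n L 0).pow n)
  | succ k ih =>
    have hstep := rootApprox_succ_sub_mem_ordLE (n := n) (L := L) k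
    have hpow := (isMonicOfOrder_rootApprox n L (k + 1)).pow_sub_pow_mem_ordLE
      (isMonicOfOrder_rootApprox n L k) hstep n
    have hcoeff := (isMonicOfOrder_rootApprox n L (k + 1)).coeff_pow_sub_pow
      (isMonicOfOrder_rootApprox n L k) hstep n
    rw [← sub_eq_add_neg] at hpow hcoeff
    rw [← sub_sub_sub_cancel_right _ _ (rootApprox n L k ^ n), Nat.cast_succ, ← sub_sub]
    refine mem_ordLE_sub_one (sub_mem ih hpow) ?_
    rw [coeff_sub, hcoeff, nsmul_coeff_rootApprox_succ_sub hn, sub_self]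

theorem sub_rootApprox_mem_ordLE (hn : IsUnit (n : C)) (hQ : Q.IsMonicOfOrder 1) (k : ℕ) :
    Q - rootApprox n (Q ^ n) k ∈ ordLE D (-k) := by
  induction k with
  | zero => simpa using hQ.sub_mem_ordLE (isMonicOfOrder_rootApprox n (Q ^ n) 0)
  | succ k ih =>
    have hcoeff := hQ.coeff_pow_sub_pow (isMonicOfOrder_rootApprox n (Q ^ n) k) ih n
    rw [← sub_eq_add_neg, ← nsmul_coeff_rootApprox_succ_sub hn, ← sub_eq_zero, ← smul_sub,
      ← coeff_sub, sub_sub_sub_cancel_right, ← Nat.cast_smul_eq_nsmul C, hn.smul_eq_zero]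
      at hcoeff
    rw [← sub_sub_sub_cancel_right _ _ (rootApprox n (Q ^ n) k), Nat.cast_succ, neg_add']
    refine mem_ordLE_sub_one (sub_mem ih (rootApprox_succ_sub_mem_ordLE k)) ?_
    rw [sub_sub_sub_cancel_right, ← neg_sub, coeff_neg, neg_eq_zero]
    exact hcoeff

theorem existsUnique_isMonicOfOrder_pow_eq (hn : IsUnit (n : C)) (hL : L.IsMonicOfOrder n) :
    ∃! Q : PseudoDiffOp D, Q.IsMonicOfOrder 1 ∧ Q ^ n = L := by
  obtain ⟨Q, hQ⟩ := exists_forall_sub_mem_ordLE (rootApprox_succ_sub_mem_ordLE (n := n) (L := L))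
  have hQ_monic : Q.IsMonicOfOrder 1 :=
    (isMonicOfOrder_rootApprox n L 0).of_sub_mem_ordLE (by simpa using hQ 0)
  have hQ_pow : Q ^ n = L := by
    refine sub_eq_zero.1 (eq_zero_of_forall_mem_ordLE (n - 1) fun k => ?_)
    rw [← sub_sub_sub_cancel_right _ _ (rootApprox n L k ^ n)]
    exact sub_mem (hQ_monic.pow_sub_pow_mem_ordLE (isMonicOfOrder_rootApprox n L k) (hQ k) n)
      (sub_rootApprox_pow_mem_ordLE hn hL k)
  refine ⟨Q, ⟨hQ_monic, hQ_pow⟩, ?_⟩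
  rintro Q' ⟨hQ'_monic, rfl⟩
  refine sub_eq_zero.1 (eq_zero_of_forall_mem_ordLE 0 fun k => ?_)
  rw [← sub_sub_sub_cancel_right _ _ (rootApprox n (Q' ^ n) k), zero_sub]
  exact sub_mem (sub_rootApprox_mem_ordLE hn hQ'_monic k) (hQ k)

end Root

section PosPart

variable {A : PseudoDiffOp D}

theorem coeff_posPart (A : PseudoDiffOp D) (i : ℤ) :
    A.posPart.coeff i = if 0 ≤ i then A.coeff i else 0 := rfl

theorem isDiffOp_posPart (A : PseudoDiffOp D) : A.posPart.IsDiffOp :=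
  fun _ hi => if_neg hi.not_ge

theorem sub_posPart_mem_ordLE (A : PseudoDiffOp D) : A - A.posPart ∈ ordLE D (-1) :=
  fun i hi => by rw [coeff_sub, coeff_posPart, if_pos (by omega), sub_self]

theorem IsMonicOfOrder.posPart {m : ℤ} (hA : A.IsMonicOfOrder m) (hm : 0 ≤ m) :
    A.posPart.IsMonicOfOrder m where
  mem_ordLE i hi := by rw [coeff_posPart, hA.mem_ordLE i hi, ite_self]
  coeff_eq_one := by rw [coeff_posPart, if_pos hm, hA.coeff_eq_one]

theorem coeff_posPart_pow_sub_one (hA : A.IsMonicOfOrder 1) (h0 : A.coeff 0 = 0) (j : ℕ) :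
    (A ^ j).posPart.coeff (j - 1) = 0 := by
  rw [coeff_posPart, hA.coeff_pow_sub_one, h0, smul_zero, ite_self]

end PosPart

section AlmostCommuting

variable {A L : PseudoDiffOp D}

theorem mem_almostCommuting_iff {n : ℤ} (hL : L.ord = n) :
    A ∈ almostCommuting L ↔ A.IsDiffOp ∧ L * A - A * L ∈ ordLE D (n - 2) := by
  refine and_congr_right fun _ => ?_
  rw [ord_add_two_le_iff, hL]
  refine forall_congr' fun i => ?_
  rw [show ((i : WithBot ℤ) + 2) = ((i + 2 : ℤ) : WithBot ℤ) from rfl, WithBot.coe_lt_coe,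
    sub_lt_iff_lt_add]

theorem posPart_mem_almostCommuting {n : ℤ} (hL : L.ord = n) (h : Commute L A) :
    A.posPart ∈ almostCommuting L := by
  refine (mem_almostCommuting_iff hL).2 ⟨isDiffOp_posPart A, ?_⟩
  have htail : L * A.posPart - A.posPart * L = (A - A.posPart) * L - L * (A - A.posPart) := by
    rw [mul_sub, sub_mul, h.eq, sub_sub_sub_cancel_left]
  rw [htail, show n - 2 = -1 + n - 1 by ring]
  exact commutator_mem_ordLE (sub_posPart_mem_ordLE A) (mem_ordLE_iff_ord_le.2 hL.le)

theorem derivation_coeff_eq_zero_of_mem_almostCommuting [Nontrivial R] {n : ℕ}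
    (hn : IsUnit (n : C)) (hL : L.IsMonicOfOrder n) (hA : A ∈ almostCommuting L) {j : ℕ}
    (hj : A ∈ ordLE D j) : D (A.coeff j) = 0 := by
  have h := coeff_commutator hL.mem_ordLE hj
  rw [((mem_almostCommuting_iff hL.ord_eq).1 hA).2 _ (by omega), hL.coeff_eq_one, D.map_one_eq_zero,
    mul_zero, smul_zero, sub_zero, one_mul, natCast_zsmul, ← Nat.cast_smul_eq_nsmul C] at h
  exact hn.smul_eq_zero.1 h.symm

end AlmostCommuting

section Triangular

/-- The coefficient of `∂ⁱ` as a `C`-linear map. -/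
def lcoeff (D : Derivation C R R) (i : ℤ) : PseudoDiffOp D →ₗ[C] R where
  toFun A := A.coeff i
  map_add' _ _ := rfl
  map_smul' _ _ := rfl

theorem coeff_sum {ι : Type*} (s : Finset ι) (f : ι → PseudoDiffOp D) (i : ℤ) :
    (∑ l ∈ s, f l).coeff i = ∑ l ∈ s, (f l).coeff i :=
  map_sum (lcoeff D i) f s

variable {P : ℕ → PseudoDiffOp D} {W : Submodule C (PseudoDiffOp D)}

theorem linearIndependent_of_isMonicOfOrder [FaithfulSMul C R]
    (hP : ∀ j : ℕ, (P j).IsMonicOfOrder j) : LinearIndependent C P := by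
  rw [linearIndependent_iff]
  intro l hl
  by_contra hne
  obtain ⟨m, hm, hmax⟩ := l.support.exists_max_image id (Finsupp.support_nonempty_iff.2 hne)
  have hlow i (hi : i ∈ l.support) (him : i ≠ m) : l i • (P i).coeff m = 0 := by
    rw [(hP i).mem_ordLE m (by exact_mod_cast lt_of_le_of_ne (hmax i hi) him), smul_zero]
  have hlead : algebraMap C R (l m) = 0 :=
    calc algebraMap C R (l m) = l m • (P m).coeff m := by
          rw [(hP m).coeff_eq_one, Algebra.algebraMap_eq_smul_one]
      _ = ∑ i ∈ l.support, l i • (P i).coeff m :=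
          (Finset.sum_eq_single_of_mem m hm hlow).symm
      _ = (Finsupp.linearCombination C P l).coeff m := by
          rw [Finsupp.linearCombination_apply, Finsupp.sum, coeff_sum]
          rfl
      _ = 0 := by rw [hl, coeff_zero]
  exact Finsupp.mem_support_iff.1 hm
    ((map_eq_zero_iff _ (FaithfulSMul.algebraMap_injective C R)).1 hlead)

theorem span_range_eq_of_isMonicOfOrder (hdiff : ∀ A ∈ W, A.IsDiffOp)
    (hlead : ∀ A ∈ W, ∀ j : ℕ, A ∈ ordLE D j → A.coeff j ∈ Set.range (algebraMap C R))
    (hPW : ∀ j, P j ∈ W) (hP : ∀ j : ℕ, (P j).IsMonicOfOrder j) :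
    Submodule.span C (Set.range P) = W := by
  refine le_antisymm (Submodule.span_le.2 (Set.range_subset_iff.2 hPW)) fun A hA => ?_
  have mem_span_of_mem_ordLE (m : ℕ) :
      ∀ A ∈ W, A ∈ ordLE D (m - 1) → A ∈ Submodule.span C (Set.range P) := by
    induction m with
    | zero =>
      intro A hA hord
      have hA0 : A = 0 := by
        ext i
        rcases lt_or_ge i 0 with hi | hi
        · exact hdiff A hA i hi
        · exact hord i (by omega)
      exact hA0 ▸ zero_mem _
    | succ m ih =>
      intro A hA hord
      rw [Nat.cast_succ, add_sub_cancel_right] at hord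
      obtain ⟨c, hc⟩ := hlead A hA m hord
      have hcancel : (A - c • P m).coeff m = 0 := by
        rw [coeff_sub, coeff_smul, (hP m).coeff_eq_one, ← hc, Algebra.algebraMap_eq_smul_one,
          sub_self]
      rw [← sub_add_cancel A (c • P m)]
      exact add_mem
        (ih _ (sub_mem hA (W.smul_mem c (hPW m))) (mem_ordLE_sub_one
          (sub_mem hord (Submodule.smul_mem _ c (hP m).mem_ordLE)) hcancel))
        (Submodule.smul_mem _ c (Submodule.subset_span ⟨m, rfl⟩))
  obtain ⟨N, hN⟩ := A.bddAbove'
  exact mem_span_of_mem_ordLE (N + 1).toNat A hA fun i hi => hN i (by omega)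

theorem exists_basis_of_isMonicOfOrder [FaithfulSMul C R] (hdiff : ∀ A ∈ W, A.IsDiffOp)
    (hlead : ∀ A ∈ W, ∀ j : ℕ, A ∈ ordLE D j → A.coeff j ∈ Set.range (algebraMap C R))
    (hPW : ∀ j, P j ∈ W) (hP : ∀ j : ℕ, (P j).IsMonicOfOrder j) :
    ∃ b : Module.Basis ℕ C W, ∀ j, (b j : PseudoDiffOp D) = P j := by
  have hli := linearIndependent_of_isMonicOfOrder hP
  have hspan := span_range_eq_of_isMonicOfOrder hdiff hlead hPW hP
  exact ⟨(Module.Basis.span hli).map (LinearEquiv.ofEq _ _ hspan), fun j =>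
    congrArg Subtype.val (Module.Basis.span_apply hli j)⟩

end Triangular

section Grading

/-- The operators of weight `r` for a grading `𝒜` of the coefficient ring in which `∂` has
weight `1`: the coefficient of `∂ⁱ` has degree `r - i`. -/
def homogeneousSubmodule (D : Derivation C R R) (𝒜 : ℤ → Submodule C R) (r : ℤ) :
    Submodule C (PseudoDiffOp D) where
  carrier := {A | ∀ i, A.coeff i ∈ 𝒜 (r - i)}
  zero_mem' _ := zero_mem _
  add_mem' hA hB i := add_mem (hA i) (hB i)
  smul_mem' c _ hA i := Submodule.smul_mem _ c (hA i)

variable {𝒜 : ℤ → Submodule C R} {r : ℤ} {A : PseudoDiffOp D}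

theorem single_mem_homogeneousSubmodule {i : ℤ} {a : R} (ha : a ∈ 𝒜 (r - i)) :
    single D i a ∈ homogeneousSubmodule D 𝒜 r := by
  intro k
  rw [coeff_single]
  split_ifs with hk
  · exact hk ▸ ha
  · exact zero_mem _

theorem posPart_mem_homogeneousSubmodule (hA : A ∈ homogeneousSubmodule D 𝒜 r) :
    A.posPart ∈ homogeneousSubmodule D 𝒜 r := by
  intro i
  rw [coeff_posPart]
  split_ifs
  · exact hA i
  · exact zero_mem _

theorem mem_homogeneousSubmodule_of_forall_sub_mem_ordLE {F : ℕ → PseudoDiffOp D}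
    (hF : ∀ k, F k ∈ homogeneousSubmodule D 𝒜 r) (hA : ∀ k : ℕ, A - F k ∈ ordLE D (-k)) :
    A ∈ homogeneousSubmodule D 𝒜 r := by
  intro i
  have h := hA (1 - i).toNat i (by omega)
  rw [coeff_sub, sub_eq_zero] at h
  exact h ▸ hF _ i

theorem iSupIndep_homogeneousSubmodule (D : Derivation C R R) (h𝒜 : iSupIndep 𝒜) :
    iSupIndep (homogeneousSubmodule D 𝒜) := by
  intro r
  rw [Submodule.disjoint_def]
  intro A hA hA'
  ext i
  have hle : (⨆ s, ⨆ _ : s ≠ r, homogeneousSubmodule D 𝒜 s) ≤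
      (⨆ s, ⨆ _ : s ≠ r - i, 𝒜 s).comap (lcoeff D i) :=
    iSup₂_le fun s hs B hB =>
      le_iSup₂ (f := fun s (_ : s ≠ r - i) => 𝒜 s) (s - i) (by omega) (hB i)
  exact Submodule.disjoint_def.1 (h𝒜 (r - i)) _ (hA i) (hle hA')

variable [SetLike.GradedMonoid 𝒜]

theorem gradedMonoid_homogeneousSubmodule (hD : ∀ r, ∀ a ∈ 𝒜 r, D a ∈ 𝒜 (r + 1)) :
    SetLike.GradedMonoid (homogeneousSubmodule D 𝒜) where
  one_mem := single_mem_homogeneousSubmodule (by simpa using SetLike.one_mem_graded 𝒜)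
  mul_mem r s A B hA hB k := by
    have hterm (p : ℤ × ℕ) : mulTerm A B k p ∈ 𝒜 (r + s - k) := by
      have hpow := pow_apply_mem_of_forall_apply_mem (f := (D : R →ₗ[C] R)) hD
        (hB (k - p.1 + p.2)) p.2
      rw [nsmul_one] at hpow
      have hmul := SetLike.mul_mem_graded (hA p.1) hpow
      rw [show r - p.1 + (s - (k - p.1 + p.2) + p.2) = r + s - k by ring] at hmul
      exact zsmul_mem hmul _
    rw [coeff_mul, finsum_eq_sum _ (mulTerm_finite A B k)]
    exact sum_mem fun p _ => hterm p

theorem rootApprox_mem_homogeneousSubmodule (hD : ∀ r, ∀ a ∈ 𝒜 r, D a ∈ 𝒜 (r + 1)) {n : ℕ}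
    {L : PseudoDiffOp D} (hL : L ∈ homogeneousSubmodule D 𝒜 n) (k : ℕ) :
    rootApprox n L k ∈ homogeneousSubmodule D 𝒜 1 := by
  have := gradedMonoid_homogeneousSubmodule hD
  induction k with
  | zero => exact single_mem_homogeneousSubmodule (by simpa using SetLike.one_mem_graded 𝒜)
  | succ k ih =>
    have hpow := SetLike.pow_mem_graded n ih
    rw [nsmul_one] at hpow
    refine add_mem ih (single_mem_homogeneousSubmodule (Submodule.smul_mem _ _ ?_))
    convert sub_mem hL hpow (n - 1 - k) using 2
    ring

theorem IsMonicOfOrder.mem_homogeneousSubmodule_of_pow_mem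
    (hD : ∀ r, ∀ a ∈ 𝒜 r, D a ∈ 𝒜 (r + 1)) {n : ℕ} (hn : IsUnit (n : C))
    {Q : PseudoDiffOp D} (hQ : Q.IsMonicOfOrder 1) (hpow : Q ^ n ∈ homogeneousSubmodule D 𝒜 n) :
    Q ∈ homogeneousSubmodule D 𝒜 1 :=
  mem_homogeneousSubmodule_of_forall_sub_mem_ordLE (rootApprox_mem_homogeneousSubmodule hD hpow)
    (sub_rootApprox_mem_ordLE hn hQ)

theorem posPart_pow_mem_homogeneousSubmodule (hD : ∀ r, ∀ a ∈ 𝒜 r, D a ∈ 𝒜 (r + 1))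
    (hA : A ∈ homogeneousSubmodule D 𝒜 1) (j : ℕ) :
    (A ^ j).posPart ∈ homogeneousSubmodule D 𝒜 j := by
  have := gradedMonoid_homogeneousSubmodule hD
  have hpow := SetLike.pow_mem_graded j hA
  rw [nsmul_one] at hpow
  exact posPart_mem_homogeneousSubmodule hpow

end Grading

end PseudoDiffOp

namespace DiffPoly

open MvPolynomial PseudoDiffOp

variable {n : ℕ} {C : Type*} [CommRing C]

section Constants

theorem der_X (v : DiffVar n) : der n C (X v) = X (v.1, v.2 + 1) := mkDerivation_X _ _ _

theorem lie_pderiv_der (l : Set.Icc 2 n) (k : ℕ) :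
    ⁅(pderiv (l, k + 1) : Derivation C (DiffPoly n C) (DiffPoly n C)), der n C⁆ =
      pderiv (l, k) := by
  classical
  ext1 ⟨l', k'⟩
  rw [Derivation.commutator_apply, der_X, pderiv_X, pderiv_X, pderiv_X]
  by_cases h : (l', k') = (l, k)
  · obtain ⟨rfl, rfl⟩ := Prod.mk.inj h
    simp
  · have h' : ¬ (l', k' + 1) = (l, k + 1) := by simpa using h
    rw [Pi.single_eq_of_ne h', Pi.single_eq_of_ne h, Pi.single_apply]
    split_ifs <;> simp

theorem pderiv_eq_zero_of_der_eq_zero {f : DiffPoly n C} (hf : der n C f = 0) (v : DiffVar n) :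
    pderiv v f = 0 := by
  classical
  obtain ⟨l, k⟩ := v
  have descend (k : ℕ) (h : pderiv (l, k + 1) f = 0) : pderiv (l, k) f = 0 := by
    rw [← lie_pderiv_der, Derivation.commutator_apply, hf, h, map_zero, map_zero, sub_zero]
  have large (m : ℕ) (hm : f.vars.sup Prod.snd < m) : pderiv (l, m) f = 0 :=
    pderiv_eq_zero_of_notMem_vars fun h => hm.not_ge (Finset.le_sup (f := Prod.snd) h)
  exact Nat.decreasingInduction' (P := fun m => pderiv (l, m) f = 0) (fun m _ _ => descend m)
    (Nat.le_add_right k (f.vars.sup Prod.snd + 1)) (large _ (by omega))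

theorem mem_range_algebraMap_of_der_eq_zero [IsAddTorsionFree C] {f : DiffPoly n C}
    (hf : der n C f = 0) : f ∈ Set.range (algebraMap C (DiffPoly n C)) :=
  exists_C_eq_of_forall_pderiv_eq_zero (pderiv_eq_zero_of_der_eq_zero hf)

end Constants

theorem isWeightedHomogeneous_der {f : DiffPoly n C} {r : ℤ}
    (hf : IsWeightedHomogeneous (weight n) f r) :
    IsWeightedHomogeneous (weight n) (der n C f) (r + 1) := by
  refine isWeightedHomogeneous_mkDerivation (fun v => ?_) hf
  rw [show weight n v + 1 = weight n (v.1, v.2 + 1) by simp [weight, add_assoc]]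
  exact isWeightedHomogeneous_X C (weight n) _

section FormalL

variable (n C)

theorem formalL_mem_homogeneousSubmodule :
    formalL n C ∈
      homogeneousSubmodule (der n C) (weightedHomogeneousSubmodule C (weight n)) n := by
  refine add_mem (single_mem_homogeneousSubmodule ?_)
    (sum_mem fun l _ => single_mem_homogeneousSubmodule ?_)
  · simpa using isWeightedHomogeneous_one C (weight n)
  · simpa [weight] using isWeightedHomogeneous_X C (weight n) (l, 0)

theorem coeff_formalL_of_sub_one_le {i : ℤ} (hi : (n : ℤ) - 1 ≤ i) :
    (formalL n C).coeff i = if i = n then 1 else 0 := by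
  rw [formalL, PseudoDiffOp.coeff_add, PseudoDiffOp.coeff_sum, Finset.sum_eq_zero, add_zero,
    coeff_single]
  rintro ⟨l, hl⟩ -
  exact if_neg (by grind)

theorem isMonicOfOrder_formalL : (formalL n C).IsMonicOfOrder n where
  mem_ordLE i hi := by rw [coeff_formalL_of_sub_one_le n C (by omega), if_neg hi.ne']
  coeff_eq_one := by rw [coeff_formalL_of_sub_one_le n C (by omega), if_pos rfl]

theorem isNormalForm_formalL [Nontrivial C] : (formalL n C).IsNormalForm := by
  rw [(isMonicOfOrder_formalL n C).isNormalForm_iff, coeff_formalL_of_sub_one_le n C le_rfl,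
    if_neg (by omega)]

end FormalL

end DiffPoly

open PseudoDiffOp in
theorem mainTheorem3_general {C R : Type*} [CommRing C] [CommRing R] [Nontrivial R] [Algebra C R]
    [FaithfulSMul C R] {D : Derivation C R R} (𝒜 : ℤ → Submodule C R) [SetLike.GradedMonoid 𝒜]
    (h𝒜 : iSupIndep 𝒜) (hD : ∀ r, ∀ a ∈ 𝒜 r, D a ∈ 𝒜 (r + 1))
    (hconst : ∀ a, D a = 0 → a ∈ Set.range (algebraMap C R)) {n : ℕ} (hn : IsUnit (n : C))
    {L : PseudoDiffOp D} (hord : L.ord = (n : ℤ)) (hL : L.IsNormalForm)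
    (hhom : L ∈ homogeneousSubmodule D 𝒜 n) :
    (∃! Q, IsMonicRoot n L Q) ∧
    ∀ Q, IsMonicRoot n L Q →
      (∃ b : Module.Basis ℕ C (almostCommuting L),
        ∀ j, (b j : PseudoDiffOp D) = (Q ^ j).posPart) ∧
      (∀ j : ℕ, (Q ^ j).posPart ∈ homogeneousSubmodule D 𝒜 j) ∧
      (∀ T : Module.Basis ℕ C (almostCommuting L),
        (∀ j : ℕ, (T j : PseudoDiffOp D) ∈ homogeneousSubmodule D 𝒜 j) →
        ∃ c : ℕ → Cˣ, ∀ j, (T j : PseudoDiffOp D) = (c j : C) • (Q ^ j).posPart) ∧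
      (∀ j : ℕ, (Q ^ j).posPart.IsMonic ∧ (Q ^ j).posPart.IsNormalForm) := by
  have hLn : L.IsMonicOfOrder n := isMonicOfOrder_iff.2 ⟨hord, hL.1⟩
  refine ⟨by simpa only [isMonicRoot_iff] using existsUnique_isMonicOfOrder_pow_eq hn hLn,
    fun Q hQ => ?_⟩
  obtain ⟨hQ1, rfl⟩ := isMonicRoot_iff.1 hQ
  have hQ0 : Q.coeff 0 = 0 := by
    have h := hLn.isNormalForm_iff.1 hL
    rwa [hQ1.coeff_pow_sub_one, ← Nat.cast_smul_eq_nsmul C, hn.smul_eq_zero] at h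
  have hP (j : ℕ) : (Q ^ j).posPart.IsMonicOfOrder j := (hQ1.pow j).posPart j.cast_nonneg
  have hPhom : ∀ j : ℕ, (Q ^ j).posPart ∈ homogeneousSubmodule D 𝒜 j :=
    posPart_pow_mem_homogeneousSubmodule hD (hQ1.mem_homogeneousSubmodule_of_pow_mem hD hn hhom)
  obtain ⟨b, hb⟩ := exists_basis_of_isMonicOfOrder (W := almostCommuting (Q ^ n))
    (fun _ hA => hA.1)
    (fun _ hA _ hj => hconst _ (derivation_coeff_eq_zero_of_mem_almostCommuting hn hLn hA hj))
    (fun j => posPart_mem_almostCommuting hord (Commute.pow_pow_self Q n j)) hP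
  refine ⟨⟨b, hb⟩, hPhom, fun T hT => ?_, fun j =>
    ⟨(hP j).isMonic, (hP j).isNormalForm_iff.2 (coeff_posPart_pow_sub_one hQ1 hQ0 j)⟩⟩
  have hindep := (iSupIndep_homogeneousSubmodule D h𝒜).comp (Nat.cast_injective (R := ℤ))
  obtain ⟨c, hc⟩ := exists_units_smul_eq_of_iSupIndep hindep b T (fun j => hb j ▸ hPhom j) hT
  exact ⟨c, fun j => by rw [hc, Submodule.coe_smul, hb]⟩

theorem mainTheorem3 {C : Type*} [Field C] [CharZero C] (n : ℕ) (hn : 1 ≤ n) :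
    (∃! Q, PseudoDiffOp.IsMonicRoot n (DiffPoly.formalL n C) Q) ∧
    ∀ Q, PseudoDiffOp.IsMonicRoot n (DiffPoly.formalL n C) Q →
      (∃ b : Module.Basis ℕ C (PseudoDiffOp.almostCommuting (DiffPoly.formalL n C)),
        ∀ j, (b j : PseudoDiffOp (DiffPoly.der n C)) = (Q ^ j).posPart) ∧
      (∀ j : ℕ, DiffPoly.IsHomogeneousOp (Q ^ j).posPart j) ∧
      (∀ T : Module.Basis ℕ C (PseudoDiffOp.almostCommuting (DiffPoly.formalL n C)),
        (∀ j : ℕ, DiffPoly.IsHomogeneousOp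
          (T j : PseudoDiffOp (DiffPoly.der n C)) j) →
        ∃ c : ℕ → Cˣ, ∀ j,
          (T j : PseudoDiffOp (DiffPoly.der n C)) = (c j : C) • (Q ^ j).posPart) ∧
      (∀ j : ℕ, (Q ^ j).posPart.IsMonic ∧ (Q ^ j).posPart.IsNormalForm) := by
  have := MvPolynomial.WeightedHomogeneousSubmodule.gradedMonoid (R := C) (w := DiffPoly.weight n)
  exact mainTheorem3_general (MvPolynomial.weightedHomogeneousSubmodule C (DiffPoly.weight n))
    (iSupIndep_weightedHomogeneousSubmodule _) (fun _ _ => DiffPoly.isWeightedHomogeneous_der)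
    (fun _ => DiffPoly.mem_range_algebraMap_of_der_eq_zero)
    (Nat.cast_ne_zero.2 (by omega)).isUnit (DiffPoly.isMonicOfOrder_formalL n C).ord_eq
    (DiffPoly.isNormalForm_formalL n C) (DiffPoly.formalL_mem_homogeneousSubmodule n C)
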